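/- Definitions. Let $\beta\in\mathbb{C}$ with $|\beta|>1$. An alphabet is a finite set $\mathcal{A}\subset\mathbb{C}$ with $0\in\mathcal{A}$, and $$\mathrm{Fin}_\beta(\mathcal{A})=\Big\{\sum_{j=-m}^{n}x_j\beta^j : m,n\in\mathbb{N},\ x_j\in\mathcal{A}\Big\}.$$ For alphabets $\mathcal{A},\mathcal{B}$, a function $\varphi:\mathcal{B}^{\mathbb{Z}}\to\mathcal{A}^{\mathbb{Z}}$ is $p$-local if there are integers $r,t\ge 0$ with $p=r+t+1$ and a function $\phi:\mathcal{B}^p\to\mathcal{A}$ such that $\varphi(w)_j=\phi(w_{j+t},\dots,w_{j-r})$ for all $w\in\mathcal{B}^{\mathbb{Z}}$ and $j\in\mathbb{Z}$. Parallel addition in $(\beta,\mathcal{A})$ is a function $\varphi:(\mathcal{A}+\mathcal{A})^{\mathbb{Z}}\to\mathcal{A}^{\mathbb{Z}}$, $p$-local for some $p$, such that for every $w$ with only finitely many non-zero digits, $z=\varphi(w)$ has only finitely many non-zero digits and $\sum_{j\in\mathbb{Z}}w_j\beta^j=\sum_{j\in\mathbb{Z}}z_j\beta^j$. For an integer $k\ge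 1$, $(\beta,\mathcal{A})$ allows $k$-block parallel addition if there exists parallel addition in $(\beta^k,\mathcal{A}_{(k)})$, where $\mathcal{A}_{(k)}=\{a_{k-1}\beta^{k-1}+\dots+a_1\beta+a_0 : a_i\in\mathcal{A}\}$; for $k=1$ this is parallel addition in $(\beta,\mathcal{A})$. Theorem. Let $\beta$ be a complex number with $|\beta|>1$. There exists an alphabet $\mathcal{A}\subset\mathbb{Z}[\beta]$ with $0\in\mathcal{A}$ and $1\in\mathrm{Fin}_\beta(\mathcal{A})$ such that $(\beta,\mathcal{A})$ allows $k$-block parallel addition for some integer $k\ge 1$, if and only if $\beta$ is an algebraic number with no conjugate (over $\mathbb{Q}$) of modulus $1$. If this is the case, then there also exists an alphabet $\mathcal{A}\subset\mathbb{Z}$ with $0\in\mathcal{A}$ and $1\in\mathrm{Fin}_\beta(\mathcal{A})$ such that $(\beta,\mathcal{A})$ allows $1$-block parallel addition. -/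

import Mathlib

open scoped Pointwise

namespace ParAdd

/-- An alphabet (digit set): a finite set of complex numbers containing `0`. -/
def IsAlphabet (A : Set ℂ) : Prop :=
  A.Finite ∧ (0 : ℂ) ∈ A

/-- `Fin_β(A)`: the numbers having a representation in base `β` with digits in `A` and only
finitely many non-zero digits, at exponents between `-m` and `n`. -/
def finRep (β : ℂ) (A : Set ℂ) : Set ℂ :=
  {x | ∃ (m n : ℕ) (d : ℤ → ℂ), (∀ j ∈ Finset.Icc (-(m : ℤ)) (n : ℤ), d j ∈ A) ∧
    x = ∑ j ∈ Finset.Icc (-(m : ℤ)) (n : ℤ), d j * β ^ j}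

/-- `φ : B^ℤ → A^ℤ` is `p`-local: `p = r + t + 1` and the digit of `φ w` at position `j` is
`Φ (w_{j+t}, …, w_{j-r})` for one fixed function `Φ : B^p → A`. -/
def IsLocal (p : ℕ) {A B : Set ℂ} (φ : (ℤ → B) → (ℤ → A)) : Prop :=
  ∃ r t : ℕ, p = r + t + 1 ∧ ∃ Φ : (Fin p → B) → A,
    ∀ (w : ℤ → B) (j : ℤ), φ w j = Φ (fun i => w (j + (t : ℤ) - ((i : ℕ) : ℤ)))

/-- The sequence `w` of digits has only finitely many non-zero digits. -/
def FinitelyManyNonzero {A : Set ℂ} (w : ℤ → A) : Prop :=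
  {j : ℤ | (w j : ℂ) ≠ 0}.Finite

/-- The value `∑ w_j β^j`; used only for sequences with finitely many non-zero digits. -/
noncomputable def value (β : ℂ) {A : Set ℂ} (w : ℤ → A) : ℂ :=
  ∑ᶠ j : ℤ, (w j : ℂ) * β ^ j

/-- Digit set conversion in base `β` from `B` to `A`. -/
def IsDigitSetConversion (β : ℂ) {A B : Set ℂ} (φ : (ℤ → B) → (ℤ → A)) : Prop :=
  ∀ w : ℤ → B, FinitelyManyNonzero w →
    FinitelyManyNonzero (φ w) ∧ value β w = value β (φ w)

/-- There is a parallel addition in `(β, A)`: a digit set conversion from `A + A` to `A` in base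
`β` that is `p`-local for some `p`. -/
def AllowsParallelAddition (β : ℂ) (A : Set ℂ) : Prop :=
  ∃ φ : (ℤ → ↥(A + A)) → (ℤ → ↥A),
    IsDigitSetConversion β φ ∧ ∃ p : ℕ, IsLocal p φ

/-- `A_(k) = {a_{k-1} β^{k-1} + ⋯ + a_1 β + a_0 : a_i ∈ A}`. -/
def blockAlphabet (β : ℂ) (A : Set ℂ) (k : ℕ) : Set ℂ :=
  {x | ∃ a : Fin k → ℂ, (∀ i, a i ∈ A) ∧ x = ∑ i, a i * β ^ (i : ℕ)}

/-- `(β, A)` allows `k`-block parallel addition (`k` a positive integer). -/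
def AllowsBlockParallelAddition (β : ℂ) (A : Set ℂ) (k : ℕ) : Prop :=
  0 < k ∧ AllowsParallelAddition (β ^ k) (blockAlphabet β A k)

/-- `β` is an algebraic number none of whose conjugates over `ℚ` (including `β` itself) has
modulus `1`. -/
def IsAlgebraicNoUnitConj (β : ℂ) : Prop :=
  IsAlgebraic ℚ β ∧ ∀ γ : ℂ, IsConjRoot ℚ β γ → ‖γ‖ ≠ 1

end ParAdd

/-! Necessity: doubling digitwise and applying the local map `l` times writes `2 ^ l * b` with
`O(l)` digits. Lifted to integer polynomials, this identity also holds at any `α` satisfying every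
integer relation of `β`. If `‖α‖ = 1`, the right side grows only linearly in `l`, against `2 ^ l` on
the left (`false_of_unit_specialization`). A conjugate on the unit circle is such an `α`; if `β` is
transcendental, `α = 1` is.

Sufficiency: for suitable `n`, every conjugate of `β ^ n` is tiny or huge. Multiplying by `X - γ` is
then nearly a shift or nearly a scaling, so one coefficient of the minimal polynomial dominates
(`exists_dominant_polynomial`). Subtracting shifted multiples of the resulting relation reduces all
digits simultaneously, as in Avizienis' algorithm (`allowsParallelAddition_of_dominant`). -/

namespace ParAdd

open Polynomial

/-! ### Necessity: linear length against exponential growth -/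

/-- A local map fixing the zero sequence spreads supports by a bounded amount. -/
lemma IsLocal.exists_support_bound {p : ℕ} {A B : Set ℂ} {φ : (ℤ → B) → (ℤ → A)}
    (hφ : IsLocal p φ) {o : B} (h0 : ∀ j, (φ (fun _ => o) j : ℂ) = 0) :
    ∃ q : ℕ, ∀ (w : ℤ → B) (N : ℕ), (∀ j : ℤ, (N : ℤ) < |j| → w j = o) →
      ∀ j : ℤ, ((N + q : ℕ) : ℤ) < |j| → (φ w j : ℂ) = 0 := by
  obtain ⟨r, t, hp, Φ, hΦ⟩ := hφ
  refine ⟨r + t, fun w N hw j hj => ?_⟩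
  have key : (fun i : Fin p => w (j + (t : ℤ) - ((i : ℕ) : ℤ))) = fun _ => o := by
    funext i
    apply hw
    have := i.2
    push_cast at hj
    rcases lt_abs.1 hj with h | h <;> apply lt_abs.2 <;> omega
  rw [hΦ, key, ← h0 j, hΦ]

/-- A digit set conversion sends the zero sequence to the zero sequence if it is local. -/
lemma IsDigitSetConversion.map_zero {γ : ℂ} {A B : Set ℂ} {φ : (ℤ → B) → (ℤ → A)}
    (hconv : IsDigitSetConversion γ φ) {p : ℕ} (hloc : IsLocal p φ) {o : B} (ho : (o : ℂ) = 0)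
    (j : ℤ) : (φ (fun _ => o) j : ℂ) = 0 := by
  have hfin := (hconv (fun _ => o) (by simp [FinitelyManyNonzero, ho])).1
  obtain ⟨r, t, hp, Φ, hΦ⟩ := hloc
  by_contra hne
  -- The image of a constant sequence is constant, so one non-zero digit recurs at every position.
  refine Set.infinite_univ (α := ℤ) (hfin.subset fun i _ => ?_)
  simpa [hΦ] using hne

lemma value_eq_sum (γ : ℂ) {A : Set ℂ} (w : ℤ → A) (N : ℕ)
    (hw : ∀ j : ℤ, (N : ℤ) < |j| → (w j : ℂ) = 0) :
    value γ w = ∑ j ∈ Finset.Icc (-(N : ℤ)) N, (w j : ℂ) * γ ^ j := by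
  apply finsum_eq_sum_of_support_subset
  intro j hj
  by_contra hc
  apply hj
  have : (N : ℤ) < |j| := by
    by_contra h
    exact hc (by simpa [← abs_le] using h)
  simp [hw j this]

lemma finitelyManyNonzero_of_bound {A : Set ℂ} (w : ℤ → A) (N : ℕ)
    (hw : ∀ j : ℤ, (N : ℤ) < |j| → (w j : ℂ) = 0) : FinitelyManyNonzero w := by
  refine (Finset.Icc (-(N : ℤ)) N).finite_toSet.subset fun j hj => ?_
  by_contra hc
  exact hj (hw j (by
    by_contra h
    exact hc (by simpa [← abs_le] using h)))

/-- Under parallel addition, `2 ^ l * b` has a representation whose length is linear in `l`. -/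
lemma AllowsParallelAddition.exists_rep_two_pow {γ : ℂ} {B : Set ℂ}
    (h : AllowsParallelAddition γ B) (h0 : (0 : ℂ) ∈ B) {b : ℂ} (hb : b ∈ B) :
    ∃ q : ℕ, ∀ l : ℕ, ∃ z : ℤ → B,
      (2 : ℂ) ^ l * b =
        ∑ j ∈ Finset.Icc (-((l * q : ℕ) : ℤ)) ((l * q : ℕ) : ℤ), (z j : ℂ) * γ ^ j := by
  obtain ⟨φ, hconv, p, hloc⟩ := h
  have h00 : (0 : ℂ) ∈ B + B := ⟨0, h0, 0, h0, by simp⟩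
  obtain ⟨q, hq⟩ := hloc.exists_support_bound (o := ⟨0, h00⟩)
    (hconv.map_zero hloc rfl)
  have main : ∀ l : ℕ, ∃ z : ℤ → B, (∀ j : ℤ, ((l * q : ℕ) : ℤ) < |j| → (z j : ℂ) = 0) ∧
      (2 : ℂ) ^ l * b = value γ z := by
    intro l
    induction l with
    | zero =>
      classical
      refine ⟨fun j => if j = 0 then ⟨b, hb⟩ else ⟨0, h0⟩, fun j hj => ?_, ?_⟩
      · have : j ≠ 0 := by rintro rfl; simp at hj
        simp [this]
      · rw [value_eq_sum _ _ 0]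
        · simp
        · intro j hj
          have : j ≠ 0 := by rintro rfl; simp at hj
          simp [this]
    | succ l ih =>
      obtain ⟨z, hz, hv⟩ := ih
      let w : ℤ → ↥(B + B) := fun j => ⟨z j + z j, Set.add_mem_add (z j).2 (z j).2⟩
      have hw0 : ∀ j : ℤ, ((l * q : ℕ) : ℤ) < |j| → (w j : ℂ) = 0 := fun j hj => by
        simp [w, hz j hj]
      have hw : ∀ j : ℤ, ((l * q : ℕ) : ℤ) < |j| → w j = ⟨0, h00⟩ := fun j hj =>
        Subtype.ext (hw0 j hj)
      refine ⟨φ w, fun j hj => hq w (l * q) hw j (by rwa [Nat.succ_mul] at hj), ?_⟩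
      rw [← (hconv w (finitelyManyNonzero_of_bound w _ hw0)).2, pow_succ, mul_right_comm, hv,
        value_eq_sum γ w _ hw0, value_eq_sum γ z _ hz, Finset.sum_mul]
      exact Finset.sum_congr rfl fun j _ => by simp only [w]; ring
  refine ⟨q, fun l => ?_⟩
  obtain ⟨z, hz, hv⟩ := main l
  exact ⟨z, by rw [hv, value_eq_sum γ z _ hz]⟩

/-- Multiplying a Laurent sum by a power of the base gives a polynomial value. -/
lemma pow_mul_sum_zpow {β : ℂ} (hβ : β ≠ 0) (k m : ℕ) (s : Finset ℤ)
    (hs : ∀ j ∈ s, -(m : ℤ) ≤ j) (d : ℤ → ℂ) :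
    β ^ (k * m) * ∑ j ∈ s, d j * (β ^ k) ^ j =
      ∑ j ∈ s, d j * β ^ (k * (j + m).toNat) := by
  rw [Finset.mul_sum]
  refine Finset.sum_congr rfl fun j hj => ?_
  have h1 : ((j + m).toNat : ℤ) = j + m := Int.toNat_of_nonneg (by linarith [hs j hj])
  have h2 : β ^ (k * (j + m).toNat) = (β ^ k) ^ ((j + m).toNat : ℤ) := by
    rw [zpow_natCast, pow_mul]
  rw [h2, h1, zpow_add₀ (pow_ne_zero _ hβ), zpow_natCast, pow_mul]
  ring

/-- No number of modulus `1` satisfies all the integer polynomial relations of `β` if block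
parallel addition is possible in base `β`. -/
theorem false_of_unit_specialization {β α : ℂ} (hβ : β ≠ 0) (hα : ‖α‖ = 1)
    (hspec : ∀ P : ℤ[X], aeval β P = 0 → aeval α P = 0) {A : Set ℂ} (hA : IsAlphabet A)
    (hAβ : A ⊆ (Algebra.adjoin ℤ {β} : Set ℂ)) (h1 : (1 : ℂ) ∈ finRep β A) {k : ℕ}
    (hk : AllowsBlockParallelAddition β A k) : False := by
  obtain ⟨k0, hadd⟩ := hk
  have hα0 : α ≠ 0 := by rintro rfl; simp at hα
  have hpoly : ∀ x ∈ Algebra.adjoin ℤ {β}, ∃ P : ℤ[X], aeval β P = x := fun x hx => by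
    rwa [Algebra.adjoin_singleton_eq_range_aeval] at hx
  set B := blockAlphabet β A k with hB
  have hBβ : ∀ b ∈ B, b ∈ Algebra.adjoin ℤ {β} := by
    rintro b ⟨a, ha, rfl⟩
    exact Subalgebra.sum_mem _ fun i _ => Subalgebra.mul_mem _ (hAβ (ha i))
      (Subalgebra.pow_mem _ (Algebra.self_mem_adjoin_singleton ℤ β) _)
  have hBfin : B.Finite := by
    have : B ⊆ (fun a : Fin k → ℂ => ∑ i, a i * β ^ (i : ℕ)) '' Set.univ.pi (fun _ => A) := by
      rintro b ⟨a, ha, rfl⟩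
      exact ⟨a, fun i _ => ha i, rfl⟩
    exact ((Set.Finite.pi' fun _ => hA.1).image _).subset (this.trans (by
      apply Set.image_mono
      intro a ha i
      exact ha i (Set.mem_univ i)))
  have hAB : A ⊆ B := by
    intro a ha
    classical
    refine ⟨fun i => if (i : ℕ) = 0 then a else 0, fun i => ?_, ?_⟩
    · dsimp only
      split_ifs
      exacts [ha, hA.2]
    · rw [Finset.sum_eq_single ⟨0, k0⟩]
      · simp
      · intro i _ hi
        have : (i : ℕ) ≠ 0 := fun h => hi (Fin.ext h)
        simp [this]
      · simp
  choose! P hP using fun (b : ℂ) => hpoly b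
  obtain ⟨a, ha, haα⟩ : ∃ a ∈ A, aeval α (P a) ≠ 0 := by
    obtain ⟨m, n, d, hd, h1⟩ := h1
    -- If every lifted digit vanished at `α`, the lifted representation of `1` would give `α ^ m =
    -- 0`.
    by_contra! hall
    have hrel : aeval β ((X : ℤ[X]) ^ m -
        ∑ j ∈ Finset.Icc (-(m : ℤ)) n, P (d j) * X ^ (1 * (j + m).toNat)) = 0 := by
      have := pow_mul_sum_zpow hβ 1 m (Finset.Icc (-(m : ℤ)) n)
        (fun j hj => (Finset.mem_Icc.1 hj).1) d
      simp only [pow_one] at this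
      rw [← h1] at this
      simp only [map_sub, map_sum, map_mul, map_pow, aeval_X, sub_eq_zero]
      rw [one_mul, mul_one] at this
      rw [this]
      exact Finset.sum_congr rfl fun j hj => by rw [hP _ (hAβ (hd j hj))]
    have h2 := hspec _ hrel
    simp only [map_sub, map_sum, map_mul, map_pow, aeval_X] at h2
    rw [Finset.sum_eq_zero fun j hj => by rw [hall _ (hd j hj), zero_mul], sub_zero] at h2
    exact pow_ne_zero m hα0 h2
  obtain ⟨q, hq⟩ := hadd.exists_rep_two_pow (hAB hA.2) (hAB ha)
  obtain ⟨C, hC⟩ := (hBfin.image fun b => ‖aeval α (P b)‖).bddAbove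
  have hC' : ∀ b ∈ B, ‖aeval α (P b)‖ ≤ C := fun b hb => hC ⟨b, hb, rfl⟩
  have bound : ∀ l : ℕ, (2 : ℝ) ^ l * ‖aeval α (P a)‖ ≤ (2 * (l * q) + 1) * C := by
    intro l
    obtain ⟨z, hz⟩ := hq l
    set N := l * q with hN
    have hrel : aeval β ((X : ℤ[X]) ^ (k * N) * (2 ^ l * P a) -
        ∑ j ∈ Finset.Icc (-(N : ℤ)) N, P (z j) * X ^ (k * (j + N).toNat)) = 0 := by
      have := pow_mul_sum_zpow hβ k N (Finset.Icc (-(N : ℤ)) N)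
        (fun j hj => (Finset.mem_Icc.1 hj).1) (fun j => (z j : ℂ))
      simp only [map_sub, map_sum, map_mul, map_pow, aeval_X, sub_eq_zero, map_ofNat]
      rw [hP a (hAβ ha), hz, this]
      exact Finset.sum_congr rfl fun j hj => by rw [hP _ (hBβ _ (z j).2)]
    have h2 := hspec _ hrel
    simp only [map_sub, map_sum, map_mul, map_pow, aeval_X, sub_eq_zero, map_ofNat] at h2
    have h3 := congrArg norm h2
    rw [norm_mul, norm_mul, norm_pow, norm_pow, hα, one_pow, one_mul] at h3
    have h4 : ‖(2 : ℂ)‖ = 2 := by simp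
    rw [h4] at h3
    rw [h3]
    calc _ ≤ ∑ j ∈ Finset.Icc (-(N : ℤ)) N, C := by
          refine norm_sum_le_of_le _ fun j _ => ?_
          rw [norm_mul, norm_pow, hα, one_pow, mul_one]
          exact hC' _ (z j).2
      _ = _ := by
          rw [Finset.sum_const, nsmul_eq_mul, Int.card_Icc]
          have : ((N : ℤ) + 1 - -(N : ℤ)).toNat = 2 * N + 1 := by omega
          rw [this, hN]
          push_cast
          ring
  have hlim : Filter.Tendsto (fun l : ℕ => ((2 * (l * q) + 1) * C) / (2 : ℝ) ^ l) Filter.atTop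
      (nhds 0) := by
    have e1 := (tendsto_pow_const_div_const_pow_of_one_lt 1 (one_lt_two (α := ℝ))).const_mul
      (2 * q * C)
    have e2 := (tendsto_pow_const_div_const_pow_of_one_lt 0 (one_lt_two (α := ℝ))).const_mul C
    have e := e1.add e2
    simp only [mul_zero, add_zero] at e
    refine e.congr fun l => ?_
    field_simp
  have hle : ‖aeval α (P a)‖ ≤ 0 := by
    refine ge_of_tendsto hlim (Filter.Eventually.of_forall fun l => ?_)
    rw [le_div_iff₀ (by positivity), mul_comm]
    exact bound l
  exact haα (norm_le_zero_iff.1 hle)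

/-- Block parallel addition forces the base to be algebraic without conjugates of modulus `1`. -/
theorem isAlgebraicNoUnitConj_of_block {β : ℂ} (hβ : β ≠ 0) {A : Set ℂ} (hA : IsAlphabet A)
    (hAβ : A ⊆ (Algebra.adjoin ℤ {β} : Set ℂ)) (h1 : (1 : ℂ) ∈ finRep β A) {k : ℕ}
    (hk : AllowsBlockParallelAddition β A k) : IsAlgebraicNoUnitConj β := by
  refine ⟨?_, fun α hconj hα => ?_⟩
  · by_contra htr
    -- Only the zero polynomial vanishes at a transcendental `β`, so `α = 1` qualifies.
    refine false_of_unit_specialization hβ norm_one (fun P hP => ?_) hA hAβ h1 hk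
    have htr' : Transcendental ℤ β := fun h => htr (h.extendScalars (RingHom.injective_int _))
    rw [transcendental_iff.1 htr' P hP, map_zero]
  · refine false_of_unit_specialization hβ hα (fun P hP => ?_) hA hAβ h1 hk
    have h2 : aeval β (P.map (algebraMap ℤ ℚ)) = 0 := by rwa [aeval_map_algebraMap]
    have h3 := minpoly.dvd ℚ β h2
    rw [hconj] at h3
    rw [← aeval_map_algebraMap ℚ]
    exact aeval_eq_zero_of_dvd_aeval_eq_zero h3 (minpoly.aeval ℚ α)

/-! ### Sufficiency: a relation with a dominant coefficient -/

/-- A product of linear factors whose roots are all very small or very large has a dominant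
coefficient. -/
lemma exists_dominant_coeff_prod {ε : ℝ} (hε : 0 < ε) (hε1 : ε ≤ 1) (S : Multiset ℂ)
    (hS : ∀ γ ∈ S, ‖γ‖ ≤ ε ∨ 1 ≤ ε * ‖γ‖) :
    ∃ (s : ℕ) (D : ℂ), D ≠ 0 ∧ ∀ i,
      ‖(S.map fun γ => X - C γ).prod.coeff i - (if i = s then D else 0)‖ ≤
        (2 ^ S.card - 1) * ε * ‖D‖ := by
  induction S using Multiset.induction_on with
  | empty => exact ⟨0, 1, one_ne_zero, fun i => by simp [coeff_one]⟩
  | cons γ S ih =>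
    obtain ⟨s, D, hD, h⟩ := ih fun x hx => hS x (Multiset.mem_cons_of_mem hx)
    set p := (S.map fun γ => X - C γ).prod with hp
    set E : ℝ := (2 ^ S.card - 1) * ε with hE
    have hE0 : 0 ≤ E := mul_nonneg (sub_nonneg.2 (one_le_pow₀ one_le_two)) hε.le
    have hD0 : 0 < ‖D‖ := norm_pos_iff.2 hD
    -- The relative error obeys `E ↦ 2 * E + ε` from `0`, which explains `(2 ^ card - 1) * ε`.
    have hE' : (2 ^ (γ ::ₘ S).card - 1) * ε = 2 * E + ε := by
      rw [Multiset.card_cons, hE]; ring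
    have hcoef : ∀ i, ‖p.coeff i‖ ≤ (1 + E) * ‖D‖ := fun i => by
      have h1 := norm_sub_norm_le (p.coeff i) (if i = s then D else 0)
      have h2 : ‖(if i = s then D else 0 : ℂ)‖ ≤ ‖D‖ := by split_ifs <;> simp
      linarith [h i]
    have hbd : E * ‖D‖ + ε * ((1 + E) * ‖D‖) ≤ (2 * E + ε) * ‖D‖ := by
      have : ε * E ≤ E := mul_le_of_le_one_left hE0 hε1
      nlinarith
    rw [Multiset.map_cons, Multiset.prod_cons, ← hp, hE', mul_comm (X - C γ) p]
    rcases hS γ (Multiset.mem_cons_self _ _) with hγ | hγ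
    · have hsmall : ∀ i, ‖γ * p.coeff i‖ ≤ ε * ((1 + E) * ‖D‖) := fun i => by
        rw [norm_mul]
        exact mul_le_mul hγ (hcoef i) (norm_nonneg _) hε.le
      refine ⟨s + 1, D, hD, fun i => ?_⟩
      cases i with
      | zero =>
        have : (p * (X - C γ)).coeff 0 - (if 0 = s + 1 then D else 0) = -(γ * p.coeff 0) := by
          simp [mul_coeff_zero]; ring
        rw [this, norm_neg]
        refine (hsmall 0).trans (le_trans ?_ hbd)
        linarith [mul_nonneg hE0 hD0.le]
      | succ i =>
        have : (p * (X - C γ)).coeff (i + 1) - (if i + 1 = s + 1 then D else 0) =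
            (p.coeff i - (if i = s then D else 0)) - γ * p.coeff (i + 1) := by
          simp only [coeff_mul_X_sub_C, Nat.add_right_cancel_iff]; ring
        rw [this]
        exact (norm_sub_le _ _).trans ((add_le_add (h i) (hsmall _)).trans hbd)
    · have hγ0 : γ ≠ 0 := by rintro rfl; simp at hγ; linarith
      have hγp : 0 < ‖γ‖ := norm_pos_iff.2 hγ0
      -- Large root: the factor acts nearly as `-γ`, keeping the index `s` and scaling `D`.
      have hbd' : (E * ‖D‖) * ‖γ‖ + (1 + E) * ‖D‖ ≤ (2 * E + ε) * ‖-γ * D‖ := by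
        rw [norm_mul, norm_neg]
        have h1 : (1 + E) * ‖D‖ ≤ ε * ‖γ‖ * ((1 + E) * ‖D‖) :=
          le_mul_of_one_le_left (by positivity) hγ
        nlinarith [mul_le_mul_of_nonneg_right hbd hγp.le]
      refine ⟨s, -γ * D, mul_ne_zero (neg_ne_zero.2 hγ0) hD, fun i => ?_⟩
      have hmain : ‖γ * (p.coeff i - (if i = s then D else 0))‖ ≤ (E * ‖D‖) * ‖γ‖ := by
        rw [norm_mul, mul_comm]
        exact mul_le_mul_of_nonneg_right (h i) hγp.le
      cases i with
      | zero =>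
        have : (p * (X - C γ)).coeff 0 - (if 0 = s then -γ * D else 0) =
            -(γ * (p.coeff 0 - (if 0 = s then D else 0))) := by
          split_ifs <;> simp [mul_coeff_zero] <;> ring
        rw [this, norm_neg]
        refine hmain.trans (le_trans ?_ hbd')
        linarith [mul_nonneg (add_nonneg zero_le_one hE0) hD0.le]
      | succ i =>
        have : (p * (X - C γ)).coeff (i + 1) - (if i + 1 = s then -γ * D else 0) =
            p.coeff i - γ * (p.coeff (i + 1) - (if i + 1 = s then D else 0)) := by
          split_ifs <;> simp only [coeff_mul_X_sub_C] <;> ring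
        rw [this]
        refine (norm_sub_le _ _).trans (le_trans ?_ hbd')
        linarith [hcoef i]

lemma minpoly_gen_pow {F K : Type*} [Field F] [Field K] [Algebra F K] (β : K) (n : ℕ) :
    minpoly F (IntermediateField.AdjoinSimple.gen F β ^ n) = minpoly F (β ^ n) := by
  rw [IntermediateField.minpoly_eq, SubmonoidClass.coe_pow,
    IntermediateField.AdjoinSimple.coe_gen]

/-- The conjugates of `β ^ n` are `n`-th powers of conjugates of `β`. -/
lemma exists_conj_pow_eq {F K : Type*} [Field F] [Field K] [IsAlgClosed K] [Algebra F K] {β : K}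
    (hβ : IsAlgebraic F β) (n : ℕ) {γ : K} (hγ : aeval γ (minpoly F (β ^ n)) = 0) :
    ∃ α : K, aeval α (minpoly F β) = 0 ∧ α ^ n = γ := by
  have : Algebra.IsAlgebraic F (IntermediateField.adjoin F {β}) :=
    IntermediateField.isAlgebraic_adjoin_simple hβ.isIntegral
  have hmem : γ ∈ (minpoly F (IntermediateField.AdjoinSimple.gen F β ^ n)).rootSet K := by
    rw [mem_rootSet, minpoly_gen_pow]
    exact ⟨minpoly.ne_zero (hβ.isIntegral.pow n), hγ⟩
  rw [← Algebra.IsAlgebraic.range_eval_eq_rootSet_minpoly] at hmem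
  obtain ⟨ψ, hψ⟩ := hmem
  -- A root of the minimal polynomial of `β ^ n` is its image under an embedding `ψ` of `F(β)`; take
  -- `α = ψ β`.
  refine ⟨ψ (IntermediateField.AdjoinSimple.gen F β), ?_, by simpa using hψ⟩
  rw [← IntermediateField.minpoly_gen F β, aeval_algHom_apply, minpoly.aeval, map_zero]

/-- Since `β ^ n` lies in `F(β)`, the degree is bounded uniformly in `n`; this lets `ε` be fixed
before `n`. -/
lemma natDegree_minpoly_pow_le {F K : Type*} [Field F] [Field K] [Algebra F K] {β : K}
    (hβ : IsAlgebraic F β) (n : ℕ) :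
    (minpoly F (β ^ n)).natDegree ≤ (minpoly F β).natDegree := by
  have : FiniteDimensional F (IntermediateField.adjoin F {β}) :=
    IntermediateField.adjoin.finiteDimensional hβ.isIntegral
  rw [← minpoly_gen_pow, ← IntermediateField.adjoin.finrank hβ.isIntegral]
  exact minpoly.natDegree_le _

/-- The conjugates of a high power of `β` are very small or very large. -/
lemma exists_pow_conj_small_or_large {β : ℂ} (hβ : IsAlgebraicNoUnitConj β) {ε : ℝ} (hε : 0 < ε) :
    ∃ n : ℕ, ∀ γ : ℂ, aeval γ (minpoly ℚ (β ^ n)) = 0 → ‖γ‖ ≤ ε ∨ 1 ≤ ε * ‖γ‖ := by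
  have hint := hβ.1.isIntegral
  have hev : ∀ᶠ n : ℕ in Filter.atTop, ∀ α ∈ (minpoly ℚ β).rootSet ℂ,
      ‖α ^ n‖ ≤ ε ∨ 1 ≤ ε * ‖α ^ n‖ := by
    rw [Filter.eventually_all_finite (rootSet_finite _ _)]
    intro α hα
    have hne : ‖α‖ ≠ 1 := by
      refine hβ.2 α ?_
      rw [isConjRoot_iff_aeval_eq_zero hint]
      exact (mem_rootSet.1 hα).2
    simp only [norm_pow]
    rcases lt_or_gt_of_ne hne with h | h
    · filter_upwards [(tendsto_pow_atTop_nhds_zero_of_lt_one (norm_nonneg α) h).eventually_le_const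
        hε] with n hn using Or.inl hn
    · filter_upwards [(tendsto_pow_atTop_atTop_of_one_lt h).eventually_ge_atTop (1 / ε)] with n hn
      right
      rwa [div_le_iff₀' hε] at hn
  obtain ⟨n, hn⟩ := hev.exists
  refine ⟨n, fun γ hγ => ?_⟩
  obtain ⟨α, hα, rfl⟩ := exists_conj_pow_eq hβ.1 n hγ
  exact hn α (mem_rootSet.2 ⟨minpoly.ne_zero hint, hα⟩)

/-- Some power of `β` is a root of an integer polynomial with a dominant coefficient. -/
theorem exists_dominant_polynomial {β : ℂ} (hβ : IsAlgebraicNoUnitConj β) :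
    ∃ (n s : ℕ) (G : ℤ[X]), aeval (β ^ n) G = 0 ∧ G.coeff s ≠ 0 ∧
      4 * ∑ i ∈ G.support.erase s, |G.coeff i| ≤ |G.coeff s| := by
  set d := (minpoly ℚ β).natDegree with hd
  -- Each error is then at most `‖D‖ / (8 * (d + 1))`: the other coefficients total at most `‖D‖ /
  -- 8`, the dominant one is at least `7 / 8 * ‖D‖`.
  set ε : ℝ := 1 / (8 * (d + 1) * 2 ^ d) with hε
  have h2d : (1 : ℝ) ≤ 2 ^ d := one_le_pow₀ one_le_two
  have hε0 : 0 < ε := by positivity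
  have hε1 : ε ≤ 1 := by
    rw [hε, div_le_one (by positivity)]
    nlinarith [(Nat.cast_nonneg d : (0 : ℝ) ≤ d)]
  obtain ⟨n, hn⟩ := exists_pow_conj_small_or_large hβ hε0
  set m := minpoly ℚ (β ^ n) with hm
  have hmonic : m.Monic := minpoly.monic (hβ.1.isIntegral.pow n)
  set p := m.map (algebraMap ℚ ℂ) with hp
  have hpm : p.Monic := hmonic.map _
  have hprod : (p.roots.map fun γ => X - C γ).prod = p :=
    ((IsAlgClosed.splits p).eq_prod_roots_of_monic hpm).symm
  have hcard : p.roots.card ≤ d := by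
    refine (card_roots' p).trans ?_
    rw [hp, natDegree_map]
    exact natDegree_minpoly_pow_le hβ.1 n
  obtain ⟨s, D, hD, hcoef⟩ := exists_dominant_coeff_prod hε0 hε1 p.roots fun γ hγ => hn γ (by
    have := isRoot_of_mem_roots hγ
    rwa [IsRoot.def, hp, eval_map_algebraMap] at this)
  rw [hprod] at hcoef
  have hDp : 0 < ‖D‖ := norm_pos_iff.2 hD
  have hδ : (2 ^ p.roots.card - 1) * ε * ‖D‖ ≤ ‖D‖ / (8 * (d + 1)) := by
    have h1 : ((2 : ℝ) ^ p.roots.card - 1) ≤ 2 ^ d := by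
      linarith [pow_le_pow_right₀ (one_le_two (α := ℝ)) hcard]
    calc _ ≤ (2 ^ d * ε) * ‖D‖ := by gcongr
      _ = _ := by rw [hε]; field_simp
  replace hcoef := fun i => (hcoef i).trans hδ
  -- Clearing denominators scales all coefficients alike and preserves dominance.
  obtain ⟨b, hb, hG⟩ := IsLocalization.integerNormalization_spec (nonZeroDivisors ℤ) m
  set G := IsLocalization.integerNormalization (nonZeroDivisors ℤ) m with hGdef
  have hb0 : b ≠ 0 := nonZeroDivisors.ne_zero hb
  have hbp : 0 < |(b : ℝ)| := abs_pos.2 (Int.cast_ne_zero.2 hb0)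
  have hGc : ∀ i, |((G.coeff i : ℤ) : ℝ)| = |(b : ℝ)| * ‖p.coeff i‖ := fun i => by
    have h1 : ((G.coeff i : ℤ) : ℚ) = b * m.coeff i := by
      have := congrArg (fun f => f.coeff i) hG
      simpa [coeff_map] using this
    have h2 : ((G.coeff i : ℤ) : ℂ) = b * p.coeff i := by
      rw [hp, coeff_map, eq_ratCast, ← Rat.cast_intCast, h1]
      push_cast
      rfl
    have h3 := congrArg norm h2
    rwa [norm_mul, Complex.norm_intCast, Complex.norm_intCast] at h3
  have hs : 7 / 8 * ‖D‖ ≤ ‖p.coeff s‖ := by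
    have h1 := hcoef s
    rw [if_pos rfl] at h1
    have h2 := norm_sub_norm_le D (p.coeff s)
    rw [norm_sub_rev] at h2
    have h3 : ‖D‖ / (8 * (d + 1)) ≤ ‖D‖ / 8 := by
      apply div_le_div_of_nonneg_left hDp.le (by norm_num)
      linarith [(Nat.cast_nonneg d : (0 : ℝ) ≤ d)]
    linarith
  have hsum : ∑ i ∈ G.support.erase s, ‖p.coeff i‖ ≤ ‖D‖ / 8 := by
    have hsub : G.support.erase s ⊆ Finset.range (d + 1) :=
      (Finset.erase_subset _ _).trans
        ((IsLocalization.integerNormalization_support (nonZeroDivisors ℤ) m).trans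
          (supp_subset_range (Nat.lt_succ_of_le (natDegree_minpoly_pow_le hβ.1 n))))
    have hc : ((G.support.erase s).card : ℝ) ≤ d + 1 := by
      exact_mod_cast (Finset.card_le_card hsub).trans (Finset.card_range _).le
    calc _ ≤ ∑ i ∈ G.support.erase s, ‖D‖ / (8 * (d + 1)) := by
          refine Finset.sum_le_sum fun i hi => ?_
          have := hcoef i
          rwa [if_neg (Finset.ne_of_mem_erase hi), sub_zero] at this
      _ ≤ (d + 1) * (‖D‖ / (8 * (d + 1))) := by
          rw [Finset.sum_const, nsmul_eq_mul]
          gcongr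
      _ = _ := by field_simp
  refine ⟨n, s, G, IsLocalization.integerNormalization_aeval_eq_zero _ _ (minpoly.aeval _ _),
    fun h0 => ?_, ?_⟩
  · have h1 := hGc s
    rw [h0, Int.cast_zero, abs_zero] at h1
    have : 0 < |(b : ℝ)| * ‖p.coeff s‖ := mul_pos hbp (by linarith)
    linarith
  · have : (4 * ∑ i ∈ G.support.erase s, |((G.coeff i : ℤ) : ℝ)|) ≤ |((G.coeff s : ℤ) : ℝ)| := by
      simp only [hGc, ← Finset.mul_sum]
      rw [mul_left_comm]
      exact mul_le_mul_of_nonneg_left (by linarith) hbp.le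
    exact_mod_cast this

/-! ### Sufficiency: the carry algorithm -/

lemma isLocal_of_window {A B : Set ℂ} {φ : (ℤ → B) → (ℤ → A)} (T : ℕ)
    (h : ∀ (w w' : ℤ → B) (j j' : ℤ), (∀ i : ℤ, |i| ≤ T → w (j + i) = w' (j' + i)) →
      φ w j = φ w' j') : IsLocal (T + T + 1) φ := by
  -- The tuple is spread around position `0`; the wrapped values of `Fin.ofNat` lie outside the
  -- window and do not matter.
  refine ⟨T, T, rfl, fun v => φ (fun j => v (Fin.ofNat _ ((T : ℤ) - j).toNat)) 0,
    fun w j => h _ _ _ _ fun i hi => ?_⟩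
  have hi' := abs_le.1 hi
  congr 1
  have : ((T : ℤ) - (0 + i)).toNat % (T + T + 1) = ((T : ℤ) - (0 + i)).toNat :=
    Nat.mod_eq_of_lt (by omega)
  simp only [Fin.val_ofNat, this]
  omega

lemma finsum_shift_mul_zpow {β : ℂ} (hβ : β ≠ 0) (u : ℤ → ℂ) (e : ℤ) :
    ∑ᶠ j : ℤ, u (j - e) * β ^ j = β ^ e * ∑ᶠ j : ℤ, u j * β ^ j := by
  rw [← finsum_comp_equiv (Equiv.addRight e), mul_finsum]
  refine finsum_congr fun j => ?_
  simp only [Equiv.coe_addRight, add_sub_cancel_right, zpow_add₀ hβ]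
  ring

/-- The carry emitted by a digit, for the threshold `c`. -/
noncomputable def carry (c : ℤ) (x : ℂ) : ℤ :=
  if (c : ℝ) < x.re then 1 else if x.re < -(c : ℝ) then -1 else 0

lemma carry_zero {c : ℤ} (hc : 0 ≤ c) : carry c 0 = 0 := by
  simp [carry, hc.not_gt]

lemma abs_carry_le (c : ℤ) (x : ℂ) : |carry c x| ≤ 1 := by
  unfold carry; split_ifs <;> simp

/-- A digit above `c` is at most `2 * a ≤ b + c` and at least `c + 1 ≥ b - c`, so removing `b` lands
in `[-c, c]`; the negative case is symmetric. -/
lemma abs_sub_carry_le {a b c x : ℤ} (hac : 2 * a ≤ b + c) (hb : b ≤ 2 * c + 1)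
    (hx : |x| ≤ 2 * a) : |x - b * carry c x| ≤ c := by
  have hx' := abs_le.1 hx
  have e1 : ((c : ℝ) < (x : ℂ).re) ↔ c < x := by simp
  have e2 : ((x : ℂ).re < -(c : ℝ)) ↔ x < -c := by
    simp only [Complex.intCast_re]; exact_mod_cast Iff.rfl
  rw [abs_le]
  unfold carry
  simp only [e1, e2]
  split_ifs <;> constructor <;> omega

/-- A relation `b + ∑ f i * β ^ e i = 0` with dominant `b` yields parallel addition on a symmetric
interval of integers. -/
theorem allowsParallelAddition_of_dominant {β : ℂ} (hβ : β ≠ 0) {ι : Type*} (I : Finset ι)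
    (e f : ι → ℤ) {b : ℤ} (hb : 0 < b) (hdom : 4 * ∑ i ∈ I, |f i| ≤ b)
    (hrel : (b : ℂ) + ∑ i ∈ I, (f i : ℂ) * β ^ e i = 0) :
    ∃ a : ℤ, 1 ≤ a ∧ AllowsParallelAddition β ((Int.cast : ℤ → ℂ) '' Set.Icc (-a) a) := by
  set M := ∑ i ∈ I, |f i| with hM
  have hM0 : 0 ≤ M := Finset.sum_nonneg fun _ _ => abs_nonneg _
  set a := b - M with ha
  set c := b - 2 * M with hc
  set A : Set ℂ := (Int.cast : ℤ → ℂ) '' Set.Icc (-a) a with hA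
  have hdigit : ∀ x : ↥(A + A), ∃ y : ℤ, (y : ℂ) = x ∧ |y| ≤ 2 * a := by
    rintro ⟨_, _, ⟨y, hy, rfl⟩, _, ⟨z, hz, rfl⟩, rfl⟩
    refine ⟨y + z, by simp, abs_le.2 ?_⟩
    have := hy.1; have := hy.2; have := hz.1; have := hz.2
    constructor <;> linarith
  let q : ↥(A + A) → ℤ := fun x => carry c x
  -- At each position the relation, shifted there, is subtracted `q` times.
  let z : (ℤ → ↥(A + A)) → ℤ → ℂ := fun w j =>
    (w j : ℂ) - b * q (w j) - ∑ i ∈ I, (f i : ℂ) * q (w (j - e i))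
  have hz : ∀ w j, z w j ∈ A := by
    intro w j
    obtain ⟨y, hy, hya⟩ := hdigit (w j)
    refine ⟨y - b * carry c y - ∑ i ∈ I, f i * q (w (j - e i)), ?_, by simp [z, q, hy]⟩
    have h1 := abs_le.1 (abs_sub_carry_le (a := a) (b := b) (c := c) (by omega) (by omega) hya)
    have h2 : |∑ i ∈ I, f i * q (w (j - e i))| ≤ M := by
      refine (Finset.abs_sum_le_sum_abs _ _).trans (Finset.sum_le_sum fun i _ => ?_)
      rw [abs_mul]
      exact mul_le_of_le_one_right (abs_nonneg _) (abs_carry_le _ _)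
    have h3 := abs_le.1 h2
    constructor <;> omega
  refine ⟨a, by omega, fun w j => ⟨z w j, hz w j⟩, fun w hw => ?_, _,
    isLocal_of_window (∑ i ∈ I, (e i).natAbs) fun w w' j j' hww => ?_⟩
  · let u : ℤ → ℂ := fun j => (q (w j) : ℂ)
    have hu : u.support.Finite := by
      refine hw.subset fun j hj h0 => hj ?_
      simp only [u, q, h0, carry_zero (show 0 ≤ c by omega), Int.cast_zero]
    have hshift : ∀ i, (fun j => u (j - e i)).support.Finite := fun i => by
      refine (hu.image fun j => j + e i).subset fun j hj => ⟨j - e i, hj, by simp⟩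
    have hw' : (fun j => (w j : ℂ) * β ^ j).support.Finite :=
      hw.subset fun j hj h0 => hj (by simp [h0])
    have hu' : (fun j => (b : ℂ) * (u j * β ^ j)).support.Finite :=
      hu.subset fun j hj h0 => hj (by simp [h0])
    have hf' : ∀ i ∈ I, (fun j => (f i : ℂ) * (u (j - e i) * β ^ j)).support.Finite := fun i _ =>
      (hshift i).subset fun j hj h0 => hj (by simp only at h0; simp [h0])
    have hs' : (fun j => ∑ i ∈ I, (f i : ℂ) * (u (j - e i) * β ^ j)).support.Finite :=
      (I.finite_toSet.biUnion hf').subset fun j hj => by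
        obtain ⟨i, hi, h⟩ := Finset.exists_ne_zero_of_sum_ne_zero hj
        exact Set.mem_biUnion hi h
    have hzeq : ∀ j, z w j * β ^ j = (w j : ℂ) * β ^ j - b * (u j * β ^ j) -
        ∑ i ∈ I, (f i : ℂ) * (u (j - e i) * β ^ j) := fun j => by
      simp only [z, u, sub_mul, Finset.sum_mul, mul_assoc]
    constructor
    · have : (fun j => z w j * β ^ j).support.Finite := by
        simp only [hzeq]
        exact ((hw'.union hu').subset (Function.support_sub _ _)).union hs' |>.subset
          (Function.support_sub _ _)
      exact this.subset fun j hj h0 => hj (by simpa [zpow_ne_zero j hβ] using h0)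
    · have hval : ∑ᶠ j, z w j * β ^ j = value β w - b * ∑ᶠ j, u j * β ^ j -
          ∑ i ∈ I, (f i : ℂ) * (β ^ e i * ∑ᶠ j, u j * β ^ j) := by
        simp only [hzeq]
        rw [finsum_sub_distrib ((hw'.union hu').subset (Function.support_sub _ _)) hs',
          finsum_sub_distrib hw' hu', finsum_sum_comm I _ hf', value]
        rw [mul_finsum]
        congr 1
        refine Finset.sum_congr rfl fun i _ => ?_
        rw [← finsum_shift_mul_zpow hβ, mul_finsum]
      change value β w = ∑ᶠ j, z w j * β ^ j
      -- The total change is the zero relation times the value of the carry sequence.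
      have h0 : (b + ∑ i ∈ I, (f i : ℂ) * β ^ e i) * ∑ᶠ j, u j * β ^ j = 0 := by
        rw [hrel, zero_mul]
      rw [add_mul, Finset.sum_mul] at h0
      simp only [mul_assoc] at h0
      rw [hval, sub_sub, h0, sub_zero]
  · refine Subtype.ext ?_
    have hw0 : w j = w' j' := by simpa using hww 0 (by simp; positivity)
    have hwe : ∀ i ∈ I, w (j - e i) = w' (j' - e i) := fun i hi => by
      have := hww (-e i) (by
        rw [abs_neg, Int.abs_eq_natAbs]
        exact_mod_cast Finset.single_le_sum (f := fun i => (e i).natAbs)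
          (fun _ _ => Nat.zero_le _) hi)
      simpa [sub_eq_add_neg] using this
    simp only [z, hw0]
    rw [Finset.sum_congr rfl fun i hi => by rw [hwe i hi]]

lemma blockAlphabet_one (β : ℂ) (A : Set ℂ) : blockAlphabet β A 1 = A := by
  ext x
  constructor
  · rintro ⟨a, ha, rfl⟩
    simpa using ha 0
  · exact fun hx => ⟨fun _ => x, fun _ => hx, by simp⟩

/-- An algebraic base without conjugates of modulus `1` admits parallel addition on an alphabet of
integers. -/
theorem exists_int_alphabet {β : ℂ} (hβ : β ≠ 0) (h : IsAlgebraicNoUnitConj β) :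
    ∃ A : Set ℂ, IsAlphabet A ∧ A ⊆ Set.range (Int.cast : ℤ → ℂ) ∧
      (1 : ℂ) ∈ finRep β A ∧ AllowsBlockParallelAddition β A 1 := by
  obtain ⟨n, s, G, hG, hs, hdom⟩ := exists_dominant_polynomial h
  set σ := (G.coeff s).sign with hσ
  have hσ1 : |σ| = 1 := by
    rcases lt_or_gt_of_ne hs with h | h <;> simp [hσ, Int.sign_eq_neg_one_of_neg,
      Int.sign_eq_one_of_pos, h]
  -- Dividing by `(β ^ n) ^ s` and fixing the sign by `σ` puts the dominant term at exponent `0`.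
  -- Powers of `β ^ n` are read as powers of `β`, so no blocks are needed.
  obtain ⟨a, ha, hadd⟩ := allowsParallelAddition_of_dominant hβ (G.support.erase s)
    (fun i => n * ((i : ℤ) - s)) (fun i => σ * G.coeff i) (b := |G.coeff s|)
    (abs_pos.2 hs) (by simpa [abs_mul, hσ1] using hdom) (by
      have h1 : ∑ i ∈ G.support, (G.coeff i : ℂ) * (β ^ n) ^ i = 0 := by
        rw [aeval_eq_sum_range' (Nat.lt_succ_self _)] at hG
        rw [← hG]
        simp only [zsmul_eq_mul]
        refine Finset.sum_subset (supp_subset_range (Nat.lt_succ_self _)) fun i _ hi => ?_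
        simp [notMem_support_iff.1 hi]
      rw [← Finset.add_sum_erase _ _ (mem_support_iff.2 hs)] at h1
      have h2 := congrArg (fun x => (σ : ℂ) * x / (β ^ n) ^ s) h1
      have hne : (β ^ n) ^ s ≠ 0 := pow_ne_zero _ (pow_ne_zero _ hβ)
      simp only [mul_zero, zero_div, mul_add, add_div, Finset.mul_sum, Finset.sum_div] at h2
      rw [← h2]
      congr 1
      · rw [← Int.sign_mul_self_eq_abs, ← hσ]
        push_cast
        field_simp
      · refine Finset.sum_congr rfl fun i _ => ?_
        rw [zpow_mul, zpow_natCast, zpow_sub₀ (pow_ne_zero _ hβ), zpow_natCast, zpow_natCast]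
        push_cast
        ring)
  refine ⟨_, ⟨(Set.finite_Icc (-a) a).image _, 0, ⟨by omega, by omega⟩, by simp⟩,
    Set.image_subset_range _ _, ⟨0, 0, fun _ => 1, fun j _ => ?_, by simp⟩, one_pos, ?_⟩
  · exact ⟨1, ⟨by omega, ha⟩, by simp⟩
  · rwa [pow_one, blockAlphabet_one]

end ParAdd

theorem mainTheorem1 (β : ℂ) (hβ : 1 < ‖β‖) :
    ((∃ A : Set ℂ, ParAdd.IsAlphabet A ∧ A ⊆ (Algebra.adjoin ℤ {β} : Set ℂ) ∧
        (1 : ℂ) ∈ ParAdd.finRep β A ∧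
        ∃ k : ℕ, ParAdd.AllowsBlockParallelAddition β A k) ↔
      ParAdd.IsAlgebraicNoUnitConj β) ∧
    (ParAdd.IsAlgebraicNoUnitConj β →
      ∃ A : Set ℂ, ParAdd.IsAlphabet A ∧ A ⊆ Set.range (Int.cast : ℤ → ℂ) ∧
        (1 : ℂ) ∈ ParAdd.finRep β A ∧
        ParAdd.AllowsBlockParallelAddition β A 1) := by
  have hβ0 : β ≠ 0 := norm_pos_iff.1 (by linarith)
  refine ⟨⟨?_, fun h => ?_⟩, ParAdd.exists_int_alphabet hβ0⟩
  · rintro ⟨A, hA, hAβ, h1, k, hk⟩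
    exact ParAdd.isAlgebraicNoUnitConj_of_block hβ0 hA hAβ h1 hk
  · obtain ⟨A, hA, hAZ, h1, hk⟩ := ParAdd.exists_int_alphabet hβ0 h
    refine ⟨A, hA, fun x hx => ?_, h1, 1, hk⟩
    obtain ⟨y, rfl⟩ := hAZ hx
    exact intCast_mem (Algebra.adjoin ℤ {β}) y
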